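/- Let \((2,3)\)-Maharaja Nim be the impartial game played with one piece on \(\mathbb{N}_0\times\mathbb{N}_0\) in which two players alternately move the piece from \((x,y)\) either to \((x-t,y)\), \((x,y-t)\) or \((x-t,y-t)\) for some integer \(t\ge 1\), or to \((x-2,y-3)\) or \((x-3,y-2)\), coordinates staying non-negative; a player who cannot move loses. A position is a P-position if the second player to move has a winning strategy. A P-position \((x,y)\) is *upper* if \(y>x\) and *lower* if \(y<x\). The *bit-string* of the game is the sequence of bits indexed by the columns \(x=1,2,3,\dots\) whose bit is \(0\) if column \(x\) has an upper P-position and \(1\) otherwise. Consider the dictionary \[ 0\to 10,\qquad 1\to 0,\qquad 01000\to 100011100,\qquad 01010\to 10001100, \] and the following process. It starts with the string \(0100011100000\), of which the first \(8\) bits have been read. In each step, the read head, which has read the first \(r\) bits of the current string, detects the longest left hand side word \(w\) of the dictionary that occurs beginning at bit \(r+1\); the translate of \(w\) is concatenated at the end of the string, and the read head moves to the end of \(w\). Then the dictionary is correct, in the following sense. 1. A column \(x\ge1\) has bit \(1\) if and only if it has a lower P-position. 2. The process never terminates and is uniquely determined, and the string that it generates is the bit-string of the game: at each stage the current string is an initial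 segment of the bit-string, and each bit of the bit-string is eventually written and read. 3. Suppose that, before some step, \(r\) bits have been read and the string has length \(L\). Then \(r<L\), and the differences \(y-x\) of the P-positions \((x,y)\) with \(x\le y\) and \(x\le r\) are precisely \(0,1,\dots,L-r-1\). Let \(w\) be the word read in the step, of length \(m\). Say that a column \(c\ge1\) *meets the criterion* if, for some \(n\), the differences \(y-x\) of the P-positions \((x,y)\) with \(x\le y\) and \(x<c\) are precisely \(0,\dots,n-1\), and \((c,c+n)\) is a P-position. If \(w\neq 1\), then among the columns \(r+1,\dots,r+m\) precisely column \(r+1\) meets the criterion; if \(w=1\), then column \(r+1\) does not meet it. 4. In the situation of 3, the \(i\)-th bit of the translate of \(w\) is \(1\) if and only if row \(L+i\) has an upper P-position in one of the columns \(r+1,\dots,r+m\). 5. Whenever the word \(01000\) is read, the next word read is \(1\). The words \(0\), \(1\) are never read consecutively followed by a word beginning with \(0\). Consequently the P-positions lie within bounded distance of the lines \(\phi n\) and \(n/\phi\), where \(\phi=\frac{1+\sqrt5}{2}\): there is a constant \(C\) such that each P-position \((x,y)\) satisfies \(|y-\phi x|\le C\) if \(y\ge x\), and \(|y-x/\phi|\le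 C\) if \(y\le x\). -/

import Mathlib

namespace MaharajaNim

/-- `Move k l p q`: in `(k, l)`-Maharaja Nim the piece may be moved from `p` to `q`. The moves are
those of a Queen and jumps of the forms `(k, l)` and `(l, k)`, where no coordinate increases. -/
def Move (k l : ℕ) (p q : ℕ × ℕ) : Prop :=
  (∃ t, 0 < t ∧ p = (q.1 + t, q.2)) ∨
  (∃ t, 0 < t ∧ p = (q.1, q.2 + t)) ∨
  (∃ t, 0 < t ∧ p = (q.1 + t, q.2 + t)) ∨
  p = (q.1 + k, q.2 + l) ∨
  p = (q.1 + l, q.2 + k)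

/-- `IsPPosition k l p`: the second player to move wins `(k, l)`-Maharaja Nim from `p` (a player
who cannot move loses). That is, there is a legal reply to each move of the first player, after
which the second player again wins as second player. -/
inductive IsPPosition (k l : ℕ) : ℕ × ℕ → Prop
  | intro (p : ℕ × ℕ) (reply : ℕ × ℕ → ℕ × ℕ)
      (legal : ∀ q, Move k l p q → Move k l q (reply q))
      (wins : ∀ q, Move k l p q → IsPPosition k l (reply q)) : IsPPosition k l p

/-- There is an upper P-position (strictly above the main diagonal) in column `c`. -/
def HasUpper (k l c : ℕ) : Prop := ∃ y, c < y ∧ IsPPosition k l (c, y)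

/-- There is a lower P-position in column `c`. A P-position off the origin is never on the main
diagonal, so for `c ≥ 1` it makes no difference whether `y < c` or `y ≤ c` is written here. -/
def HasLower (k l c : ℕ) : Prop := ∃ y, y < c ∧ IsPPosition k l (c, y)

open Classical in
/-- The bit-string of `(k, l)`-Maharaja Nim; its bits are indexed by the columns `c = 1, 2, …`.
The bit of column `c` is `0` if and only if there is an upper P-position in column `c`. -/
noncomputable def bitString (k l c : ℕ) : Fin 2 := if HasUpper k l c then 0 else 1

/-- An entry of a dictionary: a word (left hand side) and its translate (right hand side). -/
abbrev Entry : Type := List (Fin 2) × List (Fin 2)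

/-- The longest-match rule: `e` is an entry of `D` whose word is detected at the beginning of `s`,
and it is the longest such word. -/
def IsLongestMatch (D : List Entry) (s : List (Fin 2)) (e : Entry) : Prop :=
  e ∈ D ∧ e.1 <+: s ∧ ∀ e' ∈ D, e'.1 <+: s → e'.1.length ≤ e.1.length

/-- A state of a dictionary process: the string written so far and the number of its bits that
the read head has read. -/
structure State where
  text : List (Fin 2)
  head : ℕ

/-- `IsRun D start σ ω`: `σ 0, σ 1, …` is a non-terminating dictionary process for `D` from the
state `start`. In step `n` the entry `ω n` is selected by the longest-match rule at the read head,
its translate is concatenated at the end of the string, and the read head moves to the end of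
its word. -/
def IsRun (D : List Entry) (start : State) (σ : ℕ → State) (ω : ℕ → Entry) : Prop :=
  σ 0 = start ∧ ∀ n,
    IsLongestMatch D ((σ n).text.drop (σ n).head) (ω n) ∧
    σ (n + 1) = ⟨(σ n).text ++ (ω n).2, (σ n).head + (ω n).1.length⟩

/-- The dictionary of `(2, 3)`-Maharaja Nim. -/
def dictionary : List Entry :=
  [([0], [1, 0]),
   ([1], [0]),
   ([0, 1, 0, 0, 0], [1, 0, 0, 0, 1, 1, 1, 0, 0]),
   ([0, 1, 0, 1, 0], [1, 0, 0, 0, 1, 1, 0, 0])]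

/-- The initial string `0100011100000` (columns `1, …, 13`), of which the bits of the columns
`1, …, 8` have been read. -/
def initialState : State := ⟨[0, 1, 0, 0, 0, 1, 1, 1, 0, 0, 0, 0, 0], 8⟩

/-- The set of all differences `y - x` of the P-positions `(x, y)` with `x ≤ y` and `x ≤ c`. -/
def differences (k l c : ℕ) : Set ℕ := {d | ∃ x, x ≤ c ∧ IsPPosition k l (x, x + d)}

/-- The criterion for a new left hand side word (other than `1`) to start in column `c + 1`:
the differences of the P-positions on or above the main diagonal in the columns `0, …, c` are
precisely `0, …, n - 1`, and the P-position in column `c + 1` has difference `n`, for some `n`. -/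
def WordStartsAfter (k l c : ℕ) : Prop :=
  ∃ n, differences k l c = Set.Iio n ∧ IsPPosition k l (c + 1, c + 1 + n)

end MaharajaNim

namespace MaharajaNim

/-! ### The P-positions -/

/-! The P-positions are symmetric under reflection, and each column contains exactly one. Once the
bits say which columns have upper P-positions, each upper P-position is the lowest square that the
P-positions to its left permit (`isPPosition_of_hasUpper`). Let `r` bits be read, of a string of
length `L = r + n`. The invariant `Settled` says that the columns up to `r` use exactly the
differences below `n`, in rows up to `L`. The greedy rule then fixes the pattern of upper
P-positions in the columns of the next word. Their rows all lie beyond `L`; by reflection they are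
the columns of lower P-positions, so they are the ones of the translate
(`Settled.translate_eq_bitString`), and the invariant recurs. The only obstacle is a P-position `(r
- 1, L - 2)`, from which a jump forbids the start of a word beginning with `0`. It can arise only
after `01000`, or after `0`, `1`. A finite automaton shows that the next word is then `1`: the
translates of words along its paths are again parsed along its paths, and `correlation` is a finite
inductive invariant for this. For the golden lines, counting zeros gives `L = r + zeros r + 1` and
`zeros L = r + 1`. Hence the discrepancy of the zeros contracts by the factor `φ - 1` from `L` back
to `r`, and stays bounded. -/

/-- If `q` were winning too, the reply to `q` would be a P-position with a move to another
P-position. The induction descends along the strategy at `p`. -/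
theorem not_isPPosition_of_move {k l : ℕ} {p q : ℕ × ℕ} (hp : IsPPosition k l p)
    (h : Move k l p q) : ¬ IsPPosition k l q := by
  induction hp generalizing q with
  | intro p reply legal wins ih =>
    rintro ⟨_, reply', legal', wins'⟩
    exact ih q h (legal' _ (legal q h)) (wins' _ (legal q h))

theorem Move.add_lt {k l : ℕ} (hkl : 0 < k + l) {p q : ℕ × ℕ} (h : Move k l p q) :
    q.1 + q.2 < p.1 + p.2 := by
  rcases h with ⟨t, ht, rfl⟩ | ⟨t, ht, rfl⟩ | ⟨t, ht, rfl⟩ | rfl | rfl <;> dsimp only <;> omega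

theorem isPPosition_of_forall_move {k l : ℕ} (hkl : 0 < k + l) (p : ℕ × ℕ)
    (h : ∀ q, Move k l p q → ¬ IsPPosition k l q) : IsPPosition k l p := by
  have reply : ∀ q, ∃ q', Move k l p q → Move k l q q' ∧ IsPPosition k l q' := by
    intro q
    by_cases hpq : Move k l p q
    · by_contra! hq
      refine h q hpq (isPPosition_of_forall_move hkl q fun q' hqq' => ?_)
      exact (hq q').2 hqq'
    · exact ⟨q, fun h => absurd h hpq⟩
  choose f hf using reply
  exact ⟨p, f, fun q hq => (hf q hq).1, fun q hq => (hf q hq).2⟩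
termination_by p.1 + p.2
decreasing_by exact hpq.add_lt hkl

theorem isPPosition_iff {k l : ℕ} (hkl : 0 < k + l) (p : ℕ × ℕ) :
    IsPPosition k l p ↔ ∀ q, Move k l p q → ¬ IsPPosition k l q :=
  ⟨fun h _ => not_isPPosition_of_move h, isPPosition_of_forall_move hkl p⟩

theorem exists_move_of_not_isPPosition {k l : ℕ} (hkl : 0 < k + l) {p : ℕ × ℕ}
    (h : ¬ IsPPosition k l p) : ∃ q, Move k l p q ∧ IsPPosition k l q := by
  by_contra! h'
  exact h (isPPosition_of_forall_move hkl p h')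

theorem Move.swap {k l : ℕ} {p q : ℕ × ℕ} (h : Move k l p q) : Move k l p.swap q.swap := by
  rcases h with ⟨t, ht, rfl⟩ | ⟨t, ht, rfl⟩ | ⟨t, ht, rfl⟩ | rfl | rfl
  · exact .inr (.inl ⟨t, ht, rfl⟩)
  · exact .inl ⟨t, ht, rfl⟩
  · exact .inr (.inr (.inl ⟨t, ht, rfl⟩))
  · exact .inr (.inr (.inr (.inr rfl)))
  · exact .inr (.inr (.inr (.inl rfl)))

theorem IsPPosition.symm {k l x y : ℕ} (h : IsPPosition k l (x, y)) : IsPPosition k l (y, x) := by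
  suffices ∀ p, IsPPosition k l p → IsPPosition k l p.swap from this _ h
  intro p hp
  induction hp with
  | intro p reply legal _ ih =>
    refine ⟨p.swap, fun q => (reply q.swap).swap, fun q hq => ?_, fun q hq => ih _ ?_⟩
    · simpa using (legal q.swap (by simpa using hq.swap)).swap
    · simpa using hq.swap

theorem isPPosition_zero {k l : ℕ} (hkl : 0 < k + l) : IsPPosition k l (0, 0) := by
  refine isPPosition_of_forall_move hkl _ fun q hq => absurd (hq.add_lt hkl) ?_
  simp

/-- Two P-positions never attack each other. -/
theorem IsPPosition.apart {x y x' y' : ℕ} (h : IsPPosition 2 3 (x, y))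
    (h' : IsPPosition 2 3 (x', y')) (hx : x ≤ x') :
    (x = x' ∧ y = y') ∨ (x < x' ∧ y ≠ y' ∧ x + y' ≠ x' + y ∧
      ¬ (x' = x + 2 ∧ y' = y + 3) ∧ ¬ (x' = x + 3 ∧ y' = y + 2)) := by
  have key {q : ℕ × ℕ} : Move 2 3 (x', y') q → ¬ IsPPosition 2 3 q := not_isPPosition_of_move h'
  rcases hx.eq_or_lt with rfl | hlt
  · left
    refine ⟨rfl, ?_⟩
    by_contra hne
    rcases lt_or_gt_of_ne hne with hlt | hlt
    · exact key (.inr (.inl ⟨y' - y, by omega, by ext <;> simp; omega⟩)) h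
    · exact not_isPPosition_of_move h (.inr (.inl ⟨y - y', by omega, by ext <;> simp; omega⟩)) h'
  · refine .inr ⟨hlt, ?_, ?_, ?_, ?_⟩
    · rintro rfl
      exact key (.inl ⟨x' - x, by omega, by ext <;> simp; omega⟩) h
    · intro hd
      exact key (.inr (.inr (.inl ⟨x' - x, by omega, by ext <;> simp <;> omega⟩))) h
    · rintro ⟨rfl, rfl⟩
      exact key (.inr (.inr (.inr (.inl rfl)))) h
    · rintro ⟨rfl, rfl⟩
      exact key (.inr (.inr (.inr (.inr rfl)))) h

theorem IsPPosition.unique {x y y' : ℕ} (h : IsPPosition 2 3 (x, y))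
    (h' : IsPPosition 2 3 (x, y')) : y = y' := by
  have := h.apart h' le_rfl
  omega

theorem not_isPPosition_diagonal {c : ℕ} (hc : 1 ≤ c) : ¬ IsPPosition 2 3 (c, c) := by
  intro h
  have := (isPPosition_zero (k := 2) (l := 3) (by norm_num)).apart h (Nat.zero_le c)
  omega

theorem exists_bound_isPPosition (c : ℕ) : ∃ B, ∀ x < c, ∀ y, IsPPosition 2 3 (x, y) → y ≤ B := by
  induction c with
  | zero => exact ⟨0, by simp⟩
  | succ c ih =>
    obtain ⟨B, hB⟩ := ih
    by_cases hc : ∃ z, IsPPosition 2 3 (c, z)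
    · obtain ⟨z, hz⟩ := hc
      refine ⟨max B z, fun x hx y hy => ?_⟩
      rcases Nat.lt_succ_iff_lt_or_eq.mp hx with hx | rfl
      · exact le_max_of_le_left (hB x hx y hy)
      · exact le_max_of_le_right (hy.unique hz).le
    · push Not at hc
      refine ⟨B, fun x hx y hy => ?_⟩
      rcases Nat.lt_succ_iff_lt_or_eq.mp hx with hx | rfl
      · exact hB x hx y hy
      · exact absurd hy (hc y)

theorem exists_isPPosition_column (c : ℕ) : ∃ y, IsPPosition 2 3 (c, y) := by
  by_contra! hc
  obtain ⟨B, hB⟩ := exists_bound_isPPosition c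
  -- A move to the left lowers the row by at most `max c 3`, so from this height it ends above `B`.
  obtain ⟨⟨x, y⟩, hm, hp⟩ := exists_move_of_not_isPPosition (by norm_num) (hc (B + c + 4))
  rcases hm with ⟨t, ht, h⟩ | ⟨t, ht, h⟩ | ⟨t, ht, h⟩ | h | h <;>
    simp only [Prod.mk.injEq] at h <;> obtain ⟨h1, h2⟩ := h
  · have := hB x (by omega) y hp
    omega
  · exact hc y (h1 ▸ hp)
  all_goals
    have := hB x (by omega) y hp
    omega

theorem hasUpper_or_hasLower {c : ℕ} (hc : 1 ≤ c) : HasUpper 2 3 c ∨ HasLower 2 3 c := by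
  obtain ⟨y, hy⟩ := exists_isPPosition_column c
  rcases lt_trichotomy c y with h | rfl | h
  · exact .inl ⟨y, h, hy⟩
  · exact absurd hy (not_isPPosition_diagonal hc)
  · exact .inr ⟨y, h, hy⟩

theorem HasUpper.not_hasLower {c : ℕ} (h : HasUpper 2 3 c) : ¬ HasLower 2 3 c := by
  rintro ⟨y, hy, hp⟩
  obtain ⟨y', hy', hp'⟩ := h
  have := hp.unique hp'
  omega

theorem bitString_eq_zero_iff {k l c : ℕ} : bitString k l c = 0 ↔ HasUpper k l c := by
  unfold bitString
  split_ifs with h <;> simp [h]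

theorem bitString_eq_one_iff_not_hasUpper {k l c : ℕ} :
    bitString k l c = 1 ↔ ¬ HasUpper k l c := by
  unfold bitString
  split_ifs with h <;> simp [h]

theorem bitString_eq_one_iff {c : ℕ} (hc : 1 ≤ c) : bitString 2 3 c = 1 ↔ HasLower 2 3 c := by
  rw [bitString_eq_one_iff_not_hasUpper]
  exact ⟨fun h => (hasUpper_or_hasLower hc).resolve_left h, fun h h' => h'.not_hasLower h⟩

/-- The upper P-position in a column is as low as the P-positions to the left permit. -/
theorem isPPosition_of_hasUpper {c y : ℕ} (hc : HasUpper 2 3 c) (hy : c < y)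
    (below : ∀ z, c < z → z < y → ¬ IsPPosition 2 3 (c, z))
    -- Squares below the diagonal need no check: a move to the left from above the diagonal never
    -- crosses it, though a `(2, 3)` jump from `y = c + 1` lands on it.
    (left : ∀ x z, x < c → x ≤ z → IsPPosition 2 3 (x, z) → z ≠ y ∧ x + y ≠ c + z ∧
      ¬ (c = x + 2 ∧ y = z + 3) ∧ ¬ (c = x + 3 ∧ y = z + 2)) : IsPPosition 2 3 (c, y) := by
  by_contra hp
  obtain ⟨⟨x, z⟩, hm, hq⟩ := exists_move_of_not_isPPosition (by norm_num) hp
  obtain ⟨u, hu, hcu⟩ := hc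
  rcases hm with ⟨t, ht, h⟩ | ⟨t, ht, h⟩ | ⟨t, ht, h⟩ | h | h <;>
    simp only [Prod.mk.injEq] at h <;> obtain ⟨h1, h2⟩ := h
  · have := left x z (by omega) (by omega) hq
    omega
  · obtain rfl := h1
    have := hq.unique hcu
    exact below z (by omega) (by omega) hq
  all_goals
    have := left x z (by omega) (by omega) hq
    omega

/-! ### The dictionary process -/

/-- The left hand side words of the dictionary: `0`, `1`, `01000` and `01010`. -/
inductive Letter
  | zero | one | long | short
  deriving DecidableEq

namespace Letter

def entry : Letter → Entry
  | zero => ([0], [1, 0])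
  | one => ([1], [0])
  | long => ([0, 1, 0, 0, 0], [1, 0, 0, 0, 1, 1, 1, 0, 0])
  | short => ([0, 1, 0, 1, 0], [1, 0, 0, 0, 1, 1, 0, 0])

/-- The word that the longest-match rule detects. -/
def detect (s : List (Fin 2)) : Letter :=
  if [0, 1, 0, 0, 0].isPrefixOf s then long
  else if [0, 1, 0, 1, 0].isPrefixOf s then short
  else if [1].isPrefixOf s then one else zero

end Letter

open Letter

theorem isLongestMatch_detect {s : List (Fin 2)} (hs : s ≠ []) :
    IsLongestMatch dictionary s (detect s).entry := by
  obtain ⟨b, t, rfl⟩ := List.exists_cons_of_ne_nil hs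
  have hb : b = 0 ∨ b = 1 := by omega
  unfold detect IsLongestMatch
  split_ifs with h1 h2 h3
  all_goals simp only [List.isPrefixOf_iff_prefix] at *
  · exact ⟨by simp [dictionary, entry], h1, by simp [dictionary, entry]⟩
  · exact ⟨by simp [dictionary, entry], h2, by simp [dictionary, entry]⟩
  · rcases hb with rfl | rfl
    · simp at h3
    · exact ⟨by simp [dictionary, entry], h3, by simp [dictionary, entry]⟩
  · rcases hb with rfl | rfl
    · exact ⟨by simp [dictionary, entry], by simp [entry], by simp [dictionary, entry]; simp_all⟩
    · simp at h3

theorem IsLongestMatch.unique {s : List (Fin 2)} {e e' : Entry}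
    (h : IsLongestMatch dictionary s e) (h' : IsLongestMatch dictionary s e') : e = e' := by
  have hlen : e.1.length = e'.1.length := le_antisymm (h'.2.2 e h.1 h.2.1) (h.2.2 e' h'.1 h'.2.1)
  have hw : e.1 = e'.1 := (List.prefix_of_prefix_length_le h.2.1 h'.2.1 hlen.le).eq_of_length hlen
  have key : ∀ e ∈ dictionary, ∀ e' ∈ dictionary, e.1 = e'.1 → e = e' := by decide
  exact key e h.1 e' h'.1 hw

theorem IsLongestMatch.eq_entry {s : List (Fin 2)} {e : Entry}
    (h : IsLongestMatch dictionary s e) : e = (detect s).entry := by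
  refine h.unique (isLongestMatch_detect ?_)
  rintro rfl
  have : e.1 = [] := List.prefix_nil.mp h.2.1
  have key : ∀ e ∈ dictionary, e.1 ≠ [] := by decide
  exact key e h.1 this

/-- The word read in a state. -/
def State.letter (s : State) : Letter := detect (s.text.drop s.head)

def State.next (s : State) : State :=
  ⟨s.text ++ s.letter.entry.2, s.head + s.letter.entry.1.length⟩

/-- The states of the dictionary process of `(2, 3)`-Maharaja Nim. -/
def process : ℕ → State
  | 0 => initialState
  | n + 1 => (process n).next

theorem Letter.length_entry_le (l : Letter) : l.entry.1.length ≤ l.entry.2.length := by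
  cases l <;> decide

theorem Letter.length_entry_pos (l : Letter) : 0 < l.entry.1.length := by
  cases l <;> decide

theorem process_head_add_le (n : ℕ) : (process n).head + 5 ≤ (process n).text.length := by
  induction n with
  | zero => decide
  | succ n ih =>
    have := (process n).letter.length_entry_le
    simp only [process, State.next, List.length_append]
    omega

theorem isLongestMatch_process (n : ℕ) : IsLongestMatch dictionary
    ((process n).text.drop (process n).head) (process n).letter.entry := by
  refine isLongestMatch_detect fun h => ?_
  have := process_head_add_le n
  have := congrArg List.length h
  simp at this
  omega

theorem isRun_process :
    IsRun dictionary initialState process fun n => (process n).letter.entry :=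
  ⟨rfl, fun n => ⟨isLongestMatch_process n, rfl⟩⟩

theorem IsRun.eq_process {σ : ℕ → State} {ω : ℕ → Entry}
    (h : IsRun dictionary initialState σ ω) :
    σ = process ∧ ω = fun n => (process n).letter.entry := by
  have hω : ∀ n, ω n = (σ n).letter.entry := fun n => (h.2 n).1.eq_entry
  have hσ : σ = process := by
    funext n
    induction n with
    | zero => exact h.1
    | succ n ih => rw [(h.2 n).2, hω, ih]; rfl
  exact ⟨hσ, hσ ▸ funext hω⟩

theorem existsUnique_isRun :
    ∃! r : (ℕ → State) × (ℕ → Entry), IsRun dictionary initialState r.1 r.2 :=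
  ⟨(process, fun n => (process n).letter.entry), isRun_process,
    fun _ hr => Prod.ext hr.eq_process.1 hr.eq_process.2⟩

/-! ### The sequence of words

A finite automaton restricts the sequence of the words that are read. Each of its states records
the last few words. The translates of the words along a path of the automaton are parsed into words
along another path, which shows by induction that the words read always follow the automaton. -/

/-- The transitions of the automaton. -/
def transitions : List (ℕ × Letter × ℕ) :=
  [(0, .zero, 1), (1, .zero, 2), (1, .short, 5), (2, .zero, 3), (2, .long, 10), (2, .short, 18),
    (3, .zero, 4), (3, .one, 15), (3, .short, 5), (4, .short, 5), (5, .zero, 6), (5, .one, 13),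
    (6, .zero, 7), (6, .short, 5), (7, .zero, 3), (7, .one, 8), (7, .long, 10), (8, .one, 9),
    (9, .zero, 1), (10, .one, 11), (11, .one, 12), (11, .long, 10), (11, .short, 5),
    (12, .zero, 1), (12, .one, 0), (13, .zero, 14), (13, .one, 12), (13, .long, 10),
    (13, .short, 5), (14, .zero, 2), (15, .one, 16), (16, .zero, 17), (16, .one, 0),
    (17, .zero, 2), (18, .one, 13)]

def follow (p : ℕ) (l : Letter) : Option ℕ :=
  (transitions.find? fun t => t.1 == p && t.2.1 == l).map fun t => t.2.2

/-- Parse one more bit. A pair consists of the automaton state after the words that have been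
parsed, and of those bits after them that do not determine a word yet. -/
def feed (x : ℕ × List (Fin 2)) (b : Fin 2) : Option (ℕ × List (Fin 2)) :=
  let u := x.2 ++ [b]
  if u = [1] then (follow x.1 .one).map (·, [])
  -- The second `0` may begin a longer word, so it stays pending. In the next case `011` rules out
  -- both long words. The bits `01001` and `01011` are rejected: they never occur at a word start.
  else if u = [0, 0] then (follow x.1 .zero).map (·, [0])
  else if u = [0, 1, 1] then
    (((follow x.1 .zero).bind (follow · .one)).bind (follow · .one)).map (·, [])
  else if u = [0, 1, 0, 0, 0] then (follow x.1 .long).map (·, [])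
  else if u = [0, 1, 0, 1, 0] then (follow x.1 .short).map (·, [])
  else if u ∈ [[0], [0, 1], [0, 1, 0], [0, 1, 0, 0], [0, 1, 0, 1]] then some (x.1, u)
  else none

def parse (x : ℕ × List (Fin 2)) (s : List (Fin 2)) : Option (ℕ × List (Fin 2)) :=
  s.foldlM feed x

theorem parse_append (x : ℕ × List (Fin 2)) (s t : List (Fin 2)) :
    parse x (s ++ t) = (parse x s).bind (parse · t) := by
  simp [parse, List.foldlM_append]

/-- Pairs of the state of the automaton at the read head and of the parser at the end of the
string. -/
def correlation : List (ℕ × ℕ × List (Fin 2)) :=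
  [(0, 3, [0]), (0, 4, [0]), (1, 3, [0, 1, 0]), (1, 4, [0, 1, 0]), (1, 6, [0, 1, 0]), (2, 5, []),
    (2, 18, []), (3, 13, [0]), (4, 13, [0, 1, 0]), (5, 1, [0]), (6, 1, [0, 1, 0]), (7, 5, []),
    (8, 5, [0]), (9, 6, [0]), (10, 1, [0]), (11, 2, [0]), (12, 3, [0]), (13, 2, [0]),
    (14, 2, [0, 1, 0]), (15, 14, [0]), (16, 2, [0]), (17, 2, [0, 1, 0]), (18, 17, [0])]

/-- The parser agrees with the longest-match rule. -/
theorem parse_five : ∀ p < 19, ∀ a b c d e : Fin 2,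
    (parse (p, []) [a, b, c, d, e]).isNone ∨
      ((follow p (detect [a, b, c, d, e])).bind fun p' =>
        parse (p', []) ([a, b, c, d, e].drop (detect [a, b, c, d, e]).entry.1.length)) =
      parse (p, []) [a, b, c, d, e] := by
  decide +kernel

/-- The finite check that makes `correlation` inductive: reading a word moves the first component,
writing its translate moves the second. -/
theorem correlation_step : ∀ x ∈ correlation, x.1 < 19 ∧
    ∀ l ∈ [Letter.zero, .one, .long, .short],
      (follow x.1 l).isNone ∨ ∃ y ∈ correlation, follow x.1 l = some y.1 ∧
        parse x.2 l.entry.2 = some y.2 := by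
  decide +kernel

theorem detect_five (a b c d e : Fin 2) (t : List (Fin 2)) :
    detect (a :: b :: c :: d :: e :: t) = detect [a, b, c, d, e] := by
  simp [detect, List.isPrefixOf]

theorem exists_cons_five {s : List (Fin 2)} (h : 5 ≤ s.length) :
    ∃ a b c d e t, s = a :: b :: c :: d :: e :: t := by
  match s, h with
  | a :: b :: c :: d :: e :: t, _ => exact ⟨a, b, c, d, e, t, rfl⟩

theorem parse_step {p : ℕ} {q : ℕ × List (Fin 2)} {s : List (Fin 2)} (hpq : (p, q) ∈ correlation)
    (hs : 5 ≤ s.length) (h : parse (p, []) s = some q) :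
    ∃ p' q', follow p (detect s) = some p' ∧ (p', q') ∈ correlation ∧
      parse (p', []) (s.drop (detect s).entry.1.length ++ (detect s).entry.2) = some q' := by
  obtain ⟨a, b, c, d, e, t, rfl⟩ := exists_cons_five hs
  obtain ⟨hp, hstep⟩ := correlation_step _ hpq
  have hfive := parse_five p hp a b c d e
  rw [detect_five]
  set l := detect [a, b, c, d, e] with hl
  have hsplit : a :: b :: c :: d :: e :: t = [a, b, c, d, e] ++ t := rfl
  rw [hsplit, parse_append, Option.bind_eq_some_iff] at h
  obtain ⟨y, hy, hyt⟩ := h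
  rw [hy] at hfive
  simp only [Option.isNone_some, Bool.false_eq_true, false_or, Option.bind_eq_some_iff] at hfive
  obtain ⟨p', hp', hparse⟩ := hfive
  rcases hstep l (by cases l <;> simp) with hn | ⟨y', hy', hf, hq⟩
  · simp [hp'] at hn
  · obtain rfl : p' = y'.1 := by simpa [hp'] using hf
    refine ⟨y'.1, y'.2, hp', hy', ?_⟩
    have hlen : l.entry.1.length ≤ [a, b, c, d, e].length := by cases l <;> simp [entry]
    rw [hsplit, List.drop_append_of_le_length hlen, parse_append, parse_append, hparse]
    simp [hyt, hq]

/-- The state of the automaton at the read head. -/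
def phase : ℕ → ℕ
  | 0 => 0
  -- The default is never used, by `follow_phase`.
  | n + 1 => (follow (phase n) (process n).letter).getD 0

theorem exists_parse_process (n : ℕ) : ∃ q, (phase n, q) ∈ correlation ∧
    parse (phase n, []) ((process n).text.drop (process n).head) = some q := by
  induction n with
  | zero => exact ⟨(4, [0]), by decide, by decide +kernel⟩
  | succ n ih =>
    obtain ⟨q, hq, h⟩ := ih
    have hn := process_head_add_le n
    obtain ⟨p', q', hp', hq', h'⟩ := parse_step hq (by simp; omega) h
    have hphase : phase (n + 1) = p' := by rw [phase, State.letter, hp']; rfl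
    refine ⟨q', hphase ▸ hq', ?_⟩
    rw [hphase, ← h', process, State.next]
    congr 1
    have hw : (process n).letter.entry.1.length ≤
        ((process n).text.drop (process n).head).length := by
      have : (process n).letter.entry.1.length ≤ 5 := by cases (process n).letter <;> simp [entry]
      simp
      omega
    rw [List.length_drop] at hw
    simp only
    rw [List.drop_append_of_le_length (by omega), List.drop_drop]
    rfl

theorem follow_phase (n : ℕ) :
    follow (phase n) (process n).letter = some (phase (n + 1)) := by
  obtain ⟨q, hq, h⟩ := exists_parse_process n
  have hn := process_head_add_le n
  obtain ⟨p', q', hp', -, -⟩ := parse_step hq (by simp; omega) h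
  rw [phase, State.letter, hp']
  rfl

theorem mem_transitions {p p' : ℕ} {l : Letter} (h : follow p l = some p') :
    (p, l, p') ∈ transitions := by
  simp only [follow, Option.map_eq_some_iff] at h
  obtain ⟨⟨a, b, c⟩, hf, rfl⟩ := h
  have h1 := List.find?_some hf
  have h2 := List.mem_of_find?_eq_some hf
  simp at h1
  obtain ⟨rfl, rfl⟩ := h1
  exact h2

theorem transition_process (n : ℕ) :
    (phase n, (process n).letter, phase (n + 1)) ∈ transitions :=
  mem_transitions (follow_phase n)

theorem letter_after_long {n : ℕ} (h : (process n).letter = .long) :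
    (process (n + 1)).letter = .one := by
  have key : ∀ t ∈ transitions, ∀ t' ∈ transitions,
      t.2.1 = .long → t.2.2 = t'.1 → t'.2.1 = .one := by decide +kernel
  exact key _ (transition_process n) _ (transition_process (n + 1)) h rfl

theorem letter_after_zero_one {n : ℕ} (h : (process n).letter = .zero)
    (h' : (process (n + 1)).letter = .one) : (process (n + 2)).letter = .one := by
  have key : ∀ t ∈ transitions, t.2.1 = .zero → ∀ t' ∈ transitions, t.2.2 = t'.1 →
      t'.2.1 = .one → ∀ t'' ∈ transitions, t'.2.2 = t''.1 → t''.2.1 = .one := by decide +kernel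
  exact key _ (transition_process n) h _ (transition_process (n + 1)) rfl h' _
    (transition_process (n + 2)) rfl

/-! ### The P-positions in the columns of a word -/

/-- The columns up to `r` have used the differences below `n` and only rows up to `r + n`. -/
structure Settled (r n : ℕ) : Prop where
  upper : ∀ x y, x ≤ r → x ≤ y → IsPPosition 2 3 (x, y) → y < x + n ∧ y ≤ r + n
  difference : ∀ d < n, ∃ x ≤ r, IsPPosition 2 3 (x, x + d)

/-- All smaller differences are taken, and two P-positions cannot share a diagonal. -/
theorem Settled.add_le {r n x y : ℕ} (h : Settled r n) (hx : r < x) (hxy : x ≤ y)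
    (hp : IsPPosition 2 3 (x, y)) : x + n ≤ y := by
  by_contra hlt
  obtain ⟨x', hx', hp'⟩ := h.difference (y - x) (by omega)
  have := hp'.apart hp (by omega)
  omega

theorem Settled.differences_eq {r n : ℕ} (h : Settled r n) : differences 2 3 r = Set.Iio n := by
  ext d
  constructor
  · rintro ⟨x, hx, hp⟩
    have := h.upper x (x + d) hx (by omega) hp
    exact Set.mem_Iio.mpr (by omega)
  · intro hd
    obtain ⟨x, hx, hp⟩ := h.difference d hd
    exact ⟨x, hx, hp⟩

/-- The upper P-positions in the columns of a word, relative to the ends of the read part and of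
the whole of the string. -/
def Letter.uppers : Letter → List (ℕ × ℕ)
  | zero => [(1, 1)]
  | one => []
  | long => [(1, 1), (3, 5), (4, 7), (5, 6)]
  | short => [(1, 1), (3, 5), (5, 6)]

/-- The upper P-positions in the columns of the word `l` are as `l.uppers` says. -/
def Placed (r n : ℕ) (l : Letter) : Prop :=
  ∀ x y, r < x → x ≤ r + l.entry.1.length → x ≤ y →
    (IsPPosition 2 3 (x, y) ↔ ∃ o ∈ l.uppers, x = r + o.1 ∧ y = r + n + o.2)

/-- The square has a new row and a new difference. A `(3, 2)` jump would start at difference `n +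
1`, which is not yet used, so only the `(2, 3)` jump excluded by `hK` could interfere. -/
theorem Settled.first {r n : ℕ} (h : Settled r n) (hn : 0 < n) (hU : HasUpper 2 3 (r + 1))
    (hK : ∀ x y, r = x + 1 → r + n = y + 2 → ¬ IsPPosition 2 3 (x, y)) :
    IsPPosition 2 3 (r + 1, r + n + 1) := by
  refine isPPosition_of_hasUpper hU (by omega) (fun z hz hz' hp => ?_) fun x z hx hxz hp => ?_
  · have := h.add_le (by omega) hz.le hp
    omega
  · have := h.upper x z (by omega) hxz hp
    refine ⟨by omega, by omega, fun hk => hK x z (by omega) (by omega) hp, by omega⟩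

/-- Difference `n` is taken by the first column of the word, and the square of difference `n + 1` is
a `(2, 3)` jump away from it. So difference `n + 2` is used, and `n + 1` is left for column `r + 5`.
-/
theorem Settled.third {r n : ℕ} (h : Settled r n) (h1 : IsPPosition 2 3 (r + 1, r + n + 1))
    (h2 : ¬ HasUpper 2 3 (r + 2)) (hU : HasUpper 2 3 (r + 3)) :
    IsPPosition 2 3 (r + 3, r + n + 5) := by
  refine isPPosition_of_hasUpper hU (by omega) (fun z hz hz' hp => ?_) fun x z hx hxz hp => ?_
  · have := h.add_le (by omega) hz.le hp
    have := h1.apart hp (by omega)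
    omega
  · obtain hx | rfl | rfl : x ≤ r ∨ x = r + 1 ∨ x = r + 2 := by omega
    · have := h.upper x z hx hxz hp
      omega
    · have := h1.unique hp
      omega
    · rcases hxz.eq_or_lt with rfl | hlt
      · exact absurd hp (not_isPPosition_diagonal (by omega))
      · exact absurd ⟨z, hlt, hp⟩ h2

theorem not_isPPosition_of_not_hasUpper {c z : ℕ} (hc : 1 ≤ c) (h : ¬ HasUpper 2 3 c)
    (hz : c ≤ z) : ¬ IsPPosition 2 3 (c, z) := by
  rcases hz.eq_or_lt with rfl | hlt
  · exact not_isPPosition_diagonal hc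
  · exact fun hp => h ⟨z, hlt, hp⟩

theorem Settled.placed_zero {r n : ℕ} (h : Settled r n) (hn : 0 < n)
    (h1 : HasUpper 2 3 (r + 1))
    (hK : ∀ x y, r = x + 1 → r + n = y + 2 → ¬ IsPPosition 2 3 (x, y)) : Placed r n .zero := by
  have p1 := h.first hn h1 hK
  intro x y hx hxm hxy
  obtain rfl : x = r + 1 := by simp [entry] at hxm; omega
  simp only [uppers, List.mem_singleton, exists_eq_left, true_and]
  exact ⟨fun hp => hp.unique p1, fun hy => hy ▸ p1⟩

theorem placed_one {r n : ℕ} (h1 : ¬ HasUpper 2 3 (r + 1)) : Placed r n .one := by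
  intro x y hx hxm hxy
  obtain rfl : x = r + 1 := by simp [entry] at hxm; omega
  simpa [uppers] using not_isPPosition_of_not_hasUpper (by omega) h1 hxy

theorem Settled.placed_short {r n : ℕ} (h : Settled r n) (hn : 0 < n)
    (h1 : HasUpper 2 3 (r + 1)) (h2 : ¬ HasUpper 2 3 (r + 2)) (h3 : HasUpper 2 3 (r + 3))
    (h4 : ¬ HasUpper 2 3 (r + 4)) (h5 : HasUpper 2 3 (r + 5))
    (hK : ∀ x y, r = x + 1 → r + n = y + 2 → ¬ IsPPosition 2 3 (x, y)) : Placed r n .short := by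
  have p1 := h.first hn h1 hK
  have p3 := h.third p1 h2 h3
  have n2 {z : ℕ} (hz : r + 2 ≤ z) := not_isPPosition_of_not_hasUpper (by omega) h2 hz
  have n4 {z : ℕ} (hz : r + 4 ≤ z) := not_isPPosition_of_not_hasUpper (by omega) h4 hz
  have p5 : IsPPosition 2 3 (r + 5, r + n + 6) := by
    refine isPPosition_of_hasUpper h5 (by omega) (fun z hz hz' hp => ?_) fun x z hx hxz hp => ?_
    · have := h.add_le (by omega) hz.le hp
      have := p1.apart hp (by omega)
      omega
    · obtain hx | rfl | rfl | rfl | rfl :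
        x ≤ r ∨ x = r + 1 ∨ x = r + 2 ∨ x = r + 3 ∨ x = r + 4 := by omega
      · have := h.upper x z hx hxz hp
        omega
      · have := p1.unique hp
        omega
      · exact absurd hp (n2 hxz)
      · have := p3.unique hp
        omega
      · exact absurd hp (n4 hxz)
  intro x y hx hxm hxy
  simp only [entry, List.length_cons, List.length_nil] at hxm
  simp only [uppers, List.mem_cons, List.not_mem_nil, or_false, exists_eq_or_imp, exists_eq_left]
  constructor
  · intro hp
    obtain rfl | rfl | rfl | rfl | rfl :
      x = r + 1 ∨ x = r + 2 ∨ x = r + 3 ∨ x = r + 4 ∨ x = r + 5 := by omega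
    · have := p1.unique hp
      omega
    · exact absurd hp (n2 hxy)
    · have := p3.unique hp
      omega
    · exact absurd hp (n4 hxy)
    · have := p5.unique hp
      omega
  · rintro (⟨rfl, rfl⟩ | ⟨rfl, rfl⟩ | ⟨rfl, rfl⟩) <;> assumption

theorem Settled.placed_long {r n : ℕ} (h : Settled r n) (hn : 0 < n)
    (h1 : HasUpper 2 3 (r + 1)) (h2 : ¬ HasUpper 2 3 (r + 2)) (h3 : HasUpper 2 3 (r + 3))
    (h4 : HasUpper 2 3 (r + 4)) (h5 : HasUpper 2 3 (r + 5))
    (hK : ∀ x y, r = x + 1 → r + n = y + 2 → ¬ IsPPosition 2 3 (x, y)) : Placed r n .long := by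
  have p1 := h.first hn h1 hK
  have p3 := h.third p1 h2 h3
  have n2 {z : ℕ} (hz : r + 2 ≤ z) := not_isPPosition_of_not_hasUpper (by omega) h2 hz
  -- Difference `n + 1` would repeat the row of `p3`, and difference `n + 2` its diagonal.
  have p4 : IsPPosition 2 3 (r + 4, r + n + 7) := by
    refine isPPosition_of_hasUpper h4 (by omega) (fun z hz hz' hp => ?_) fun x z hx hxz hp => ?_
    · have := h.add_le (by omega) hz.le hp
      have := p1.apart hp (by omega)
      have := p3.apart hp (by omega)
      omega
    · obtain hx | rfl | rfl | rfl : x ≤ r ∨ x = r + 1 ∨ x = r + 2 ∨ x = r + 3 := by omega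
      · have := h.upper x z hx hxz hp
        omega
      · have := p1.unique hp
        omega
      · exact absurd hp (n2 hxz)
      · have := p3.unique hp
        omega
  have p5 : IsPPosition 2 3 (r + 5, r + n + 6) := by
    refine isPPosition_of_hasUpper h5 (by omega) (fun z hz hz' hp => ?_) fun x z hx hxz hp => ?_
    · have := h.add_le (by omega) hz.le hp
      have := p1.apart hp (by omega)
      omega
    · obtain hx | rfl | rfl | rfl | rfl :
        x ≤ r ∨ x = r + 1 ∨ x = r + 2 ∨ x = r + 3 ∨ x = r + 4 := by omega
      · have := h.upper x z hx hxz hp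
        omega
      · have := p1.unique hp
        omega
      · exact absurd hp (n2 hxz)
      · have := p3.unique hp
        omega
      · have := p4.unique hp
        omega
  intro x y hx hxm hxy
  simp only [entry, List.length_cons, List.length_nil] at hxm
  simp only [uppers, List.mem_cons, List.not_mem_nil, or_false, exists_eq_or_imp, exists_eq_left]
  constructor
  · intro hp
    obtain rfl | rfl | rfl | rfl | rfl :
      x = r + 1 ∨ x = r + 2 ∨ x = r + 3 ∨ x = r + 4 ∨ x = r + 5 := by omega
    · have := p1.unique hp
      omega
    · exact absurd hp (n2 hxy)
    · have := p3.unique hp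
      omega
    · have := p4.unique hp
      omega
    · have := p5.unique hp
      omega
  · rintro (⟨rfl, rfl⟩ | ⟨rfl, rfl⟩ | ⟨rfl, rfl⟩ | ⟨rfl, rfl⟩) <;> assumption

/-- If the bits of the columns of a word are as the word says, then its P-positions are, too. -/
theorem Settled.placed {r n : ℕ} (h : Settled r n) (hn : 0 < n) {l : Letter}
    (bits : ∀ j < l.entry.1.length, l.entry.1[j]? = some (bitString 2 3 (r + j + 1)))
    (hK : ∀ x y, r = x + 1 → r + n = y + 2 → IsPPosition 2 3 (x, y) → l = .one) :
    Placed r n l := by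
  have zero_bit {c : ℕ} (h : some (0 : Fin 2) = some (bitString 2 3 c)) : HasUpper 2 3 c :=
    bitString_eq_zero_iff.mp (Option.some.inj h).symm
  have one_bit {c : ℕ} (h : some (1 : Fin 2) = some (bitString 2 3 c)) : ¬ HasUpper 2 3 c :=
    bitString_eq_one_iff_not_hasUpper.mp (Option.some.inj h).symm
  cases l with
  | zero =>
    exact h.placed_zero hn (zero_bit (bits 0 (by decide))) fun x y h1 h2 hp => nomatch hK x y h1 h2 hp
  | one => exact placed_one (one_bit (bits 0 (by decide)))
  | long =>
    exact h.placed_long hn (zero_bit (bits 0 (by decide))) (one_bit (bits 1 (by decide)))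
      (zero_bit (bits 2 (by decide))) (zero_bit (bits 3 (by decide)))
      (zero_bit (bits 4 (by decide))) fun x y h1 h2 hp => nomatch hK x y h1 h2 hp
  | short =>
    exact h.placed_short hn (zero_bit (bits 0 (by decide))) (one_bit (bits 1 (by decide)))
      (zero_bit (bits 2 (by decide))) (one_bit (bits 3 (by decide)))
      (zero_bit (bits 4 (by decide))) fun x y h1 h2 hp => nomatch hK x y h1 h2 hp

/-- The number of differences that a word uses. -/
def Letter.gain (l : Letter) : ℕ := l.entry.2.length - l.entry.1.length

theorem Letter.length_add_gain (l : Letter) :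
    l.entry.1.length + l.gain = l.entry.2.length := by
  cases l <;> rfl

theorem Letter.uppers_bounds (l : Letter) : ∀ o ∈ l.uppers, 1 ≤ o.1 ∧ o.1 ≤ l.entry.1.length ∧
    o.1 ≤ o.2 ∧ o.2 < o.1 + l.gain ∧ o.2 ≤ l.entry.2.length := by
  cases l <;> decide

theorem Letter.exists_mem_uppers (l : Letter) :
    ∀ d < l.gain, ∃ o ∈ l.uppers, o.2 = o.1 + d := by
  cases l <;> decide

theorem Letter.translate_eq_one_iff (l : Letter) : ∀ i < l.entry.2.length,
    (l.entry.2[i]? = some 1 ↔ ∃ o ∈ l.uppers, o.2 = i + 1) := by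
  cases l <;> decide

theorem Settled.step {r n : ℕ} (h : Settled r n) {l : Letter} (hl : Placed r n l) :
    Settled (r + l.entry.1.length) (n + l.gain) where
  upper x y hx hxy hp := by
    rcases le_or_gt x r with hxr | hxr
    · have := h.upper x y hxr hxy hp
      omega
    · obtain ⟨o, ho, rfl, rfl⟩ := (hl x y hxr hx hxy).mp hp
      have := l.uppers_bounds o ho
      have := l.length_add_gain
      omega
  difference d hd := by
    rcases lt_or_ge d n with hdn | hdn
    · obtain ⟨x, hx, hp⟩ := h.difference d hdn
      exact ⟨x, by omega, hp⟩
    · obtain ⟨o, ho, hod⟩ := l.exists_mem_uppers (d - n) (by omega)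
      have := l.uppers_bounds o ho
      refine ⟨r + o.1, by omega, (hl _ _ (by omega) (by omega) (by omega)).mpr ?_⟩
      exact ⟨o, ho, rfl, by omega⟩

/-- The rows of the upper P-positions in the columns of a word. -/
theorem Placed.translate_eq_one_iff {r n : ℕ} {l : Letter} (hl : Placed r n l) {i : ℕ}
    (hi : i < l.entry.2.length) : l.entry.2[i]? = some 1 ↔ ∃ x, r < x ∧
      x ≤ r + l.entry.1.length ∧ x < r + n + i + 1 ∧ IsPPosition 2 3 (x, r + n + i + 1) := by
  rw [l.translate_eq_one_iff i hi]
  constructor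
  · rintro ⟨o, ho, hoi⟩
    have hb := l.uppers_bounds o ho
    have hp := (hl (r + o.1) (r + n + i + 1) (by omega) (by omega) (by omega)).mpr
      ⟨o, ho, rfl, by omega⟩
    refine ⟨r + o.1, by omega, by omega, lt_of_le_of_ne (by omega) fun he => ?_, hp⟩
    rw [he] at hp
    exact not_isPPosition_diagonal (by omega) hp
  · rintro ⟨x, hx, hxm, hlt, hp⟩
    obtain ⟨o, ho, -, hoi⟩ := (hl _ _ hx hxm hlt.le).mp hp
    exact ⟨o, ho, by omega⟩

theorem Settled.translate_eq_bitString {r n : ℕ} (h : Settled r n) {l : Letter}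
    (hl : Placed r n l) {i : ℕ} (hi : i < l.entry.2.length) :
    l.entry.2[i]? = some (bitString 2 3 (r + n + i + 1)) := by
  have key : l.entry.2[i]? = some 1 ↔ bitString 2 3 (r + n + i + 1) = 1 := by
    rw [hl.translate_eq_one_iff hi, bitString_eq_one_iff (by omega)]
    constructor
    · rintro ⟨x, -, -, hlt, hp⟩
      exact ⟨x, hlt, hp.symm⟩
    · rintro ⟨x, hlt, hp⟩
      have hp := hp.symm
      -- Columns up to `r` reach only rows up to `r + n`; columns after the word reach only rows
      -- beyond the end of the translate.
      refine ⟨x, ?_, ?_, hlt, hp⟩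
      · by_contra hx
        have := h.upper x _ (by omega) hlt.le hp
        omega
      · by_contra hx
        have := (h.step hl).add_le (by omega) hlt.le hp
        have := l.length_add_gain
        omega
  rw [List.getElem?_eq_getElem hi] at key ⊢
  simp only [Option.some.injEq] at key ⊢
  have := (l.entry.2[i]).isLt
  have := (bitString 2 3 (r + n + i + 1)).isLt
  omega

/-- After its first column, a word either skips an unused difference or fills in one below a
difference already used; both violate the criterion. -/
theorem Letter.not_wordStart (l : Letter) : ∀ o ∈ l.uppers, o.1 ≠ 1 →
    (∃ e < o.2 - o.1, ∀ o' ∈ l.uppers, o'.1 < o.1 → o'.2 ≠ o'.1 + e) ∨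
      ∃ o' ∈ l.uppers, o'.1 < o.1 ∧ o.2 - o.1 < o'.2 - o'.1 := by
  cases l <;> decide

theorem Settled.wordStartsAfter_iff {r n : ℕ} (h : Settled r n) {l : Letter}
    (hl : Placed r n l) {j : ℕ} (hj : j < l.entry.1.length) :
    WordStartsAfter 2 3 (r + j) ↔ j = 0 ∧ l.entry.1 ≠ [1] := by
  constructor
  · rintro ⟨n', hd, hp⟩
    obtain ⟨o, ho, ho1, ho2⟩ := (hl _ _ (by omega) (by omega) (by omega)).mp hp
    have hb := l.uppers_bounds o ho
    obtain rfl | hj0 := Nat.eq_zero_or_pos j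
    · refine ⟨rfl, ?_⟩
      rintro h1
      obtain rfl : l = .one := by cases l <;> simp_all [entry]
      simp [uppers] at ho
    · exfalso
      rcases l.not_wordStart o ho (by omega) with ⟨e, he, hall⟩ | ⟨o', ho', hlt, hlt'⟩
      · obtain ⟨x, hx, hpx⟩ : n + e ∈ differences 2 3 (r + j) := by
          rw [hd]
          exact Set.mem_Iio.mpr (by omega)
        rcases le_or_gt x r with hxr | hxr
        · have := h.upper _ _ hxr (by omega) hpx
          omega
        · obtain ⟨o', ho', h1, h2⟩ := (hl _ _ hxr (by omega) (by omega)).mp hpx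
          exact hall o' ho' (by omega) (by omega)
      · have hb' := l.uppers_bounds o' ho'
        have hmem : n + (o'.2 - o'.1) ∈ differences 2 3 (r + j) := by
          refine ⟨r + o'.1, by omega, (hl _ _ (by omega) (by omega) (by omega)).mpr ?_⟩
          exact ⟨o', ho', rfl, by omega⟩
        rw [hd, Set.mem_Iio] at hmem
        omega
  · rintro ⟨rfl, h1⟩
    have hm : (1, 1) ∈ l.uppers := by cases l <;> simp_all [uppers, entry]
    refine ⟨n, h.differences_eq, (hl _ _ (by omega) (by omega) (by omega)).mpr ?_⟩
    exact ⟨(1, 1), hm, rfl, by dsimp only; omega⟩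

/-! ### The first columns -/

/-- The P-positions in the columns up to `8`. -/
def firstPositions : List (ℕ × ℕ) :=
  [(0, 0), (1, 2), (2, 1), (3, 6), (4, 8), (5, 7), (6, 3), (7, 5), (8, 4)]

/-- A form of `Move 2 3` that is decidable by evaluation. -/
def Attacks (p q : ℕ × ℕ) : Prop :=
  (q.1 < p.1 ∧ p.2 = q.2) ∨ (p.1 = q.1 ∧ q.2 < p.2) ∨ (q.1 < p.1 ∧ p.1 + q.2 = q.1 + p.2) ∨
    (p.1 = q.1 + 2 ∧ p.2 = q.2 + 3) ∨ (p.1 = q.1 + 3 ∧ p.2 = q.2 + 2)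

instance (p q : ℕ × ℕ) : Decidable (Attacks p q) := by unfold Attacks; infer_instance

theorem move_iff_attacks {p q : ℕ × ℕ} : Move 2 3 p q ↔ Attacks p q := by
  obtain ⟨a, b⟩ := p
  obtain ⟨c, d⟩ := q
  simp only [Move, Attacks, Prod.mk.injEq]
  constructor
  · rintro (⟨t, h⟩ | ⟨t, h⟩ | ⟨t, h⟩ | h | h) <;> omega
  · rintro (h | h | h | h | h)
    · exact .inl ⟨a - c, by omega⟩
    · exact .inr (.inl ⟨b - d, by omega⟩)
    · exact .inr (.inr (.inl ⟨a - c, by omega⟩))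
    · exact .inr (.inr (.inr (.inl h)))
    · exact .inr (.inr (.inr (.inr h)))

theorem mem_firstPositions_iff : ∀ x < 9, ∀ y < 9,
    ((x, y) ∈ firstPositions ↔ ∀ q ∈ firstPositions, ¬ Attacks (x, y) q) := by
  decide +kernel

/-- Moves stay in the box, so the P-positions in it are determined recursively;
`mem_firstPositions_iff` says that the table satisfies the recursion. -/
theorem isPPosition_iff_mem_firstPositions (x y : ℕ) (hx : x < 9) (hy : y < 9) :
    IsPPosition 2 3 (x, y) ↔ (x, y) ∈ firstPositions := by
  rw [mem_firstPositions_iff x hx y hy, isPPosition_iff (by norm_num)]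
  have small : ∀ q ∈ firstPositions, q.1 < 9 ∧ q.2 < 9 := by decide
  have ih : ∀ q, Attacks (x, y) q → (IsPPosition 2 3 q ↔ q ∈ firstPositions) := by
    rintro ⟨a, b⟩ hq
    have hlt := (move_iff_attacks.mpr hq).add_lt (by norm_num)
    dsimp only at hlt
    refine isPPosition_iff_mem_firstPositions a b ?_ ?_ <;> simp only [Attacks] at hq <;> omega
  constructor
  · intro h q hq ha
    exact h q (move_iff_attacks.mpr ha) ((ih q ha).mpr hq)
  · intro h q hm hp
    have ha := move_iff_attacks.mp hm
    exact h q ((ih q ha).mp hp) ha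
termination_by x + y

theorem mem_firstPositions_of_isPPosition {x y : ℕ} (hx : x < 9) (h : IsPPosition 2 3 (x, y)) :
    (x, y) ∈ firstPositions := by
  have key : ∀ x < 9, ∃ z < 9, (x, z) ∈ firstPositions := by decide
  obtain ⟨z, hz, hm⟩ := key x hx
  rwa [h.unique ((isPPosition_iff_mem_firstPositions x z hx hz).mpr hm)]

theorem isPPosition_of_mem_firstPositions {x y : ℕ} (h : (x, y) ∈ firstPositions) :
    IsPPosition 2 3 (x, y) := by
  have small : ∀ q ∈ firstPositions, q.1 < 9 ∧ q.2 < 9 := by decide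
  exact (isPPosition_iff_mem_firstPositions x y (small _ h).1 (small _ h).2).mpr h

theorem settled_eight : Settled 8 5 where
  upper x y hx hxy hp := by
    have key : ∀ p ∈ firstPositions, p.1 ≤ p.2 → p.2 < p.1 + 5 ∧ p.2 ≤ 8 + 5 := by decide
    exact key _ (mem_firstPositions_of_isPPosition (by omega) hp) hxy
  difference d hd := by
    have key : ∀ d < 5, ∃ x ≤ 8, (x, x + d) ∈ firstPositions := by decide
    obtain ⟨x, hx, hm⟩ := key d hd
    exact ⟨x, hx, isPPosition_of_mem_firstPositions hm⟩

theorem bitString_initialState {i : ℕ} (hi : i < 13) :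
    initialState.text[i]? = some (bitString 2 3 (i + 1)) := by
  rcases lt_or_ge i 8 with h8 | h8
  · have key : ∀ i < 8, ∃ y, (i + 1, y) ∈ firstPositions ∧
        (i + 1 < y ∧ initialState.text[i]? = some 0 ∨
          y < i + 1 ∧ initialState.text[i]? = some 1) := by
      intro i hi
      interval_cases i
      · exact ⟨2, by decide⟩
      · exact ⟨1, by decide⟩
      · exact ⟨6, by decide⟩
      · exact ⟨8, by decide⟩
      · exact ⟨7, by decide⟩
      · exact ⟨3, by decide⟩
      · exact ⟨5, by decide⟩
      · exact ⟨4, by decide⟩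
    obtain ⟨y, hm, ⟨hy, he⟩ | ⟨hy, he⟩⟩ := key i h8
    · rw [he, bitString_eq_zero_iff.mpr ⟨y, hy, isPPosition_of_mem_firstPositions hm⟩]
    · rw [he, (bitString_eq_one_iff (by omega)).mpr ⟨y, hy, isPPosition_of_mem_firstPositions hm⟩]
  · have hz : bitString 2 3 (i + 1) = 0 := by
      rw [bitString_eq_zero_iff]
      refine (hasUpper_or_hasLower (by omega)).resolve_right ?_
      rintro ⟨x, hx, hp⟩
      have hp := hp.symm
      -- A column beyond `8` has its upper P-position in row `14` or higher, while the table stays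
      -- below row `9`; so rows `9` to `13` have none.
      rcases lt_or_ge 8 x with h | h
      · have := settled_eight.add_le h hx.le hp
        omega
      · have key : ∀ p ∈ firstPositions, p.2 < 9 := by decide
        have := key _ (mem_firstPositions_of_isPPosition (by omega) hp)
        dsimp only at this
        omega
    rw [hz]
    interval_cases i <;> rfl

/-! ### Correctness of the dictionary -/

/-- The number of bits that are written, but not yet read. -/
def gap (n : ℕ) : ℕ := (process n).text.length - (process n).head

theorem head_add_gap (n : ℕ) : (process n).head + gap n = (process n).text.length := by
  have := process_head_add_le n
  unfold gap
  omega

theorem gap_pos (n : ℕ) : 0 < gap n := by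
  have := process_head_add_le n
  unfold gap
  omega

theorem process_succ (n : ℕ) : process (n + 1) =
    ⟨(process n).text ++ (process n).letter.entry.2,
      (process n).head + (process n).letter.entry.1.length⟩ := rfl

theorem gap_succ (n : ℕ) : gap (n + 1) = gap n + (process n).letter.gain := by
  have := process_head_add_le n
  have := (process n).letter.length_entry_le
  simp only [gap, process_succ, List.length_append, Letter.gain]
  omega

theorem letter_entry_getElem? (n : ℕ) {j : ℕ} (hj : j < (process n).letter.entry.1.length) :
    (process n).letter.entry.1[j]? = (process n).text[(process n).head + j]? := by
  obtain ⟨t, ht⟩ := (isLongestMatch_process n).2.1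
  rw [← List.getElem?_drop, ← ht, List.getElem?_append_left hj]

/-- What is known when `n` words have been read. The last two facts say that a jump may forbid the
P-position that the next word calls for only if this word is `1`. -/
structure Correct (n : ℕ) : Prop where
  settled : Settled (process n).head (gap n)
  bits : ∀ i < (process n).text.length, (process n).text[i]? = some (bitString 2 3 (i + 1))
  jump : ∀ x y, (process n).head = x + 1 → (process n).text.length = y + 2 →
    IsPPosition 2 3 (x, y) → (process n).letter = .one
  jump_next : ∀ y, (process n).text.length = y + 1 → IsPPosition 2 3 ((process n).head, y) →
    (process n).letter = .one → (process (n + 1)).letter = .one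

theorem Correct.placed {n : ℕ} (h : Correct n) :
    Placed (process n).head (gap n) (process n).letter := by
  refine h.settled.placed (gap_pos n) (fun j hj => ?_) fun x y hx hy hp => ?_
  · rw [letter_entry_getElem? n hj]
    refine h.bits _ ?_
    have : (process n).letter.entry.1.length ≤ 5 := by cases (process n).letter <;> decide
    have := process_head_add_le n
    omega
  · rw [head_add_gap] at hy
    exact h.jump x y hx hy hp

theorem Correct.succ {n : ℕ} (h : Correct n) : Correct (n + 1) where
  settled := by
    rw [gap_succ]
    exact h.settled.step h.placed
  bits i hi := by
    simp only [process_succ, List.length_append] at hi ⊢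
    rcases lt_or_ge i (process n).text.length with hlt | hge
    · rw [List.getElem?_append_left hlt]
      exact h.bits i hlt
    · rw [List.getElem?_append_right hge,
        h.settled.translate_eq_bitString h.placed (by omega), head_add_gap,
        Nat.add_sub_cancel' hge]
  jump x y hx hy hp := by
    have hg := head_add_gap n
    have hpos := gap_pos n
    simp only [process_succ, List.length_append] at hx hy
    have hpl := h.placed
    cases hl : (process n).letter <;> simp only [hl, entry, List.length_cons, List.length_nil]
      at hx hy hpl
    -- Before the word `0`, the square would be `(r, r + n)`, whose difference `n` is not yet used.
    · have := h.settled.upper x y (by omega) (by omega) hp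
      omega
    · obtain rfl : x = (process n).head := by omega
      exact h.jump_next y (by omega) hp hl
    -- Here the P-position `(r + 4, r + n + 7)` of the word really does forbid the start, so the
    -- automaton is needed.
    · exact letter_after_long hl
    · obtain ⟨o, ho, h1, h2⟩ := (hpl x y (by omega)
        (by simp only [entry, List.length_cons, List.length_nil]; omega) (by omega)).mp hp
      have key : ∀ o ∈ Letter.short.uppers, o.1 ≠ 4 := by decide
      exact absurd (by omega) (key o ho)
  jump_next y hy hp hone := by
    have hg := head_add_gap n
    have hpos := gap_pos n
    simp only [process_succ, List.length_append] at hy hp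
    have hpl := h.placed
    cases hl : (process n).letter <;> simp only [hl, entry, List.length_cons, List.length_nil]
      at hy hp hpl
    · exact letter_after_zero_one hl hone
    all_goals
      obtain ⟨o, ho, h1, h2⟩ := (hpl _ y (by omega)
        (by simp only [entry, List.length_cons, List.length_nil]; omega) (by omega)).mp hp
      simp only [uppers, List.mem_cons, List.not_mem_nil, or_false] at ho
    · rcases ho with rfl | rfl | rfl | rfl <;> dsimp only at h1 h2 <;> omega
    · rcases ho with rfl | rfl | rfl <;> dsimp only at h1 h2 <;> omega

theorem correct (n : ℕ) : Correct n := by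
  induction n with
  | zero =>
    have h7 : ∀ y, IsPPosition 2 3 (7, y) → y = 5 := fun y hy =>
      hy.unique (isPPosition_of_mem_firstPositions (by decide))
    refine ⟨settled_eight, fun i hi => bitString_initialState hi, fun x y hx hy hp => ?_,
      fun y hy hp hl => absurd hl (by decide)⟩
    have hx : 8 = x + 1 := hx
    have hy : 13 = y + 2 := hy
    obtain rfl : x = 7 := by omega
    have := h7 y hp
    omega
  | succ n ih => exact ih.succ

/-! ### Distance from the golden lines -/

theorem le_process_head (n : ℕ) : n + 8 ≤ (process n).head := by
  induction n with
  | zero => decide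
  | succ n ih =>
    have := (process n).letter.length_entry_pos
    simp only [process_succ]
    omega

/-- Each zero of a word is a column with an upper P-position, which uses one new difference. In the
translate these give `l.gain` ones, so the number of zeros there is the length of the word. -/
theorem Letter.count_word (l : Letter) : l.entry.1.count 0 = l.gain := by
  cases l <;> decide

theorem Letter.count_translate (l : Letter) : l.entry.2.count 0 = l.entry.1.length := by
  cases l <;> decide

theorem count_process_text (n : ℕ) : (process n).text.count 0 = (process n).head + 1 := by
  induction n with
  | zero => decide
  | succ n ih =>
    simp only [process_succ, List.count_append, ih, Letter.count_translate]
    omega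

/-- The number of zeros among the first `k` bits of the bit-string. -/
noncomputable def zeros (k : ℕ) : ℕ := ((List.range k).map fun i => bitString 2 3 (i + 1)).count 0

theorem take_process_text {n k : ℕ} (hk : k ≤ (process n).text.length) :
    (process n).text.take k = (List.range k).map fun i => bitString 2 3 (i + 1) := by
  refine List.ext_getElem? fun i => ?_
  rcases lt_or_ge i k with hi | hi
  · rw [List.getElem?_take_of_lt hi, (correct n).bits i (by omega)]
    simp [hi]
  · rw [List.getElem?_eq_none (by simp; omega), List.getElem?_eq_none (by simp; omega)]

theorem zeros_length (n : ℕ) : zeros (process n).text.length = (process n).head + 1 := by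
  rw [zeros, ← take_process_text le_rfl, List.take_length, count_process_text]

theorem gap_eq (n : ℕ) : gap n = zeros (process n).head + 1 := by
  have hle (n : ℕ) : (process n).head ≤ (process n).text.length := by
    have := process_head_add_le n
    omega
  induction n with
  | zero =>
    rw [zeros, ← take_process_text (hle 0)]
    decide
  | succ n ih =>
    rw [gap_succ, ih, zeros, zeros, ← take_process_text (hle (n + 1)), ← take_process_text (hle n),
      process_succ, ← Letter.count_word]
    obtain ⟨t, ht⟩ := (isLongestMatch_process n).2.1
    simp only
    rw [List.take_append_of_le_length ?_, List.take_add, ← ht, List.take_left, List.count_append]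
    · omega
    · have := congrArg List.length ht
      simp at this
      have := hle n
      omega

theorem zeros_mono {j k : ℕ} (h : j ≤ k) : zeros j ≤ zeros k ∧ zeros k ≤ zeros j + (k - j) := by
  obtain ⟨d, rfl⟩ := Nat.exists_eq_add_of_le h
  induction d with
  | zero => simp
  | succ d ih =>
    have := ih (by omega)
    have hstep : zeros (j + d) ≤ zeros (j + (d + 1)) ∧ zeros (j + (d + 1)) ≤ zeros (j + d) + 1 := by
      simp only [zeros, ← add_assoc, List.range_succ, List.map_append, List.count_append,
        List.map_cons, List.map_nil]
      have := List.count_le_length (a := (0 : Fin 2)) (l := [bitString 2 3 (j + d + 1)])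
      simp only [List.length_singleton] at this
      omega
    omega

theorem exists_le_lt_succ {f : ℕ → ℕ} {k : ℕ} (h0 : f 0 ≤ k) (hf : ∃ n, k < f n) :
    ∃ n, f n ≤ k ∧ k < f (n + 1) := by
  classical
  obtain ⟨m, hm⟩ : ∃ m, Nat.find hf = m + 1 :=
    Nat.exists_eq_succ_of_ne_zero fun h => absurd (h ▸ Nat.find_spec hf) (by omega)
  exact ⟨m, not_lt.mp (Nat.find_min hf (by omega)), hm ▸ Nat.find_spec hf⟩

theorem goldenRatio_bounds : 3 / 2 ≤ Real.goldenRatio ∧ Real.goldenRatio ≤ 5 / 3 := by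
  have h := Real.goldenRatio_sq
  have := Real.goldenRatio_pos
  constructor <;> nlinarith

/-- The zeros of the bit-string have density `φ - 1 = 1 / φ`, with bounded discrepancy. -/
theorem abs_zeros_sub_le (k : ℕ) : |(zeros k : ℝ) - (Real.goldenRatio - 1) * k| ≤ 30 := by
  obtain ⟨hφ, hφ'⟩ := goldenRatio_bounds
  induction k using Nat.strong_induction_on with
  | _ k ih =>
    rcases lt_or_ge k 13 with hk | hk
    · have hz := (zeros_mono (Nat.zero_le k)).2
      have h0 : zeros 0 = 0 := rfl
      have hz' : (zeros k : ℝ) ≤ 13 := by exact_mod_cast (by omega : zeros k ≤ 13)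
      have hk' : (k : ℝ) ≤ 13 := by exact_mod_cast hk.le
      have : (0 : ℝ) ≤ k := k.cast_nonneg
      have : (0 : ℝ) ≤ zeros k := (zeros k).cast_nonneg
      rw [abs_le]
      constructor <;> nlinarith
    · obtain ⟨n, hn, hn'⟩ := exists_le_lt_succ (f := fun n => (process n).text.length)
        (show (process 0).text.length ≤ k from hk)
        ⟨k, by have := le_process_head k; have := process_head_add_le k; omega⟩
      have h9 : (process n).letter.entry.2.length ≤ 9 := by cases (process n).letter <;> decide
      have hlen : (process n).text.length ≤ k ∧ k ≤ (process n).text.length + 9 := by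
        simp only [process_succ, List.length_append] at hn hn'
        omega
      have hr := ih (process n).head (by have := process_head_add_le n; omega)
      have hL := zeros_length n
      have hg := head_add_gap n
      rw [gap_eq] at hg
      generalize (process n).text.length = L at *
      generalize (process n).head = r at *
      have hm := zeros_mono hlen.1
      rw [hL] at hm
      have h1 : (r : ℝ) + (zeros r + 1) = L := by exact_mod_cast hg
      have h2 : (r : ℝ) + 1 ≤ zeros k := by exact_mod_cast hm.1
      have h3 : (zeros k : ℝ) ≤ r + 10 := by
        exact_mod_cast (by omega : zeros k ≤ r + 10)
      have h4 : (L : ℝ) ≤ k := by exact_mod_cast hlen.1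
      have h5 : (k : ℝ) ≤ L + 9 := by exact_mod_cast hlen.2
      have hsq := Real.goldenRatio_sq
      generalize Real.goldenRatio = φ at *
      -- As `φ (φ - 1) = 1`, the discrepancy at `L` is `2 - φ` minus `φ - 1` times that at `r`.
      -- Going from `L` to `k` costs at most `9`, and `30 * (2 / 3) + 1 / 2 + 9 < 30` closes the
      -- induction.
      have key : (r : ℝ) + 1 - (φ - 1) * L =
          2 - φ - (φ - 1) * (zeros r - (φ - 1) * r) := by
        rw [← h1]
        linear_combination (-(r : ℝ)) * hsq
      rw [abs_le] at hr ⊢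
      constructor <;> nlinarith

theorem abs_sub_goldenRatio_mul_le {x y : ℕ} (hxy : x ≤ y) (hp : IsPPosition 2 3 (x, y)) :
    |(y : ℝ) - Real.goldenRatio * x| ≤ 60 := by
  obtain ⟨hφ, hφ'⟩ := goldenRatio_bounds
  rw [abs_le]
  rcases le_or_gt x 8 with hx | hx
  · have h := settled_eight.upper x y hx hxy hp
    have h1 : (x : ℝ) ≤ 8 := by exact_mod_cast hx
    have h2 : (y : ℝ) ≤ x + 5 := by exact_mod_cast h.1.le
    have h3 : (x : ℝ) ≤ y := by exact_mod_cast hxy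
    have : (0 : ℝ) ≤ x := x.cast_nonneg
    constructor <;> nlinarith
  · obtain ⟨n, hn, hn'⟩ := exists_le_lt_succ (f := fun n => (process n).head) (k := x - 1)
      (show 8 ≤ x - 1 by omega) ⟨x, by have := le_process_head x; omega⟩
    have hn' : x - 1 < (process n).head + (process n).letter.entry.1.length := hn'
    obtain ⟨o, ho, rfl, hy⟩ := ((correct n).placed x y (by omega) (by omega) hxy).mp hp
    have hb := (process n).letter.uppers_bounds o ho
    have h5 : (process n).letter.entry.1.length ≤ 5 := by cases (process n).letter <;> decide
    have h9 : (process n).letter.entry.2.length ≤ 9 := by cases (process n).letter <;> decide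
    have hz := abs_zeros_sub_le (process n).head
    rw [gap_eq] at hy
    generalize (process n).head = r at *
    have h1 : (y : ℝ) = r + (zeros r + 1) + o.2 := by exact_mod_cast hy
    have h2 : (o.1 : ℝ) ≤ 5 := by exact_mod_cast (by omega : o.1 ≤ 5)
    have h3 : (o.2 : ℝ) ≤ 9 := by exact_mod_cast (by omega : o.2 ≤ 9)
    have : (0 : ℝ) ≤ o.1 := o.1.cast_nonneg
    have : (0 : ℝ) ≤ o.2 := o.2.cast_nonneg
    rw [abs_le] at hz
    rw [h1]
    push_cast
    constructor <;> nlinarith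

end MaharajaNim

open MaharajaNim in
theorem mainTheorem6 :
    -- the bit `1` means that there is a lower P-position in the column
    (∀ c : ℕ, 1 ≤ c → (bitString 2 3 c = 1 ↔ HasLower 2 3 c)) ∧
    -- the dictionary process does not terminate and it is unique
    (∃! r : (ℕ → State) × (ℕ → Entry), IsRun dictionary initialState r.1 r.2) ∧
    (∀ (σ : ℕ → State) (ω : ℕ → Entry), IsRun dictionary initialState σ ω →
      -- it writes exactly the bit-string of the game
      (∀ n i : ℕ, i < (σ n).text.length → (σ n).text[i]? = some (bitString 2 3 (i + 1))) ∧
      (∀ i : ℕ, ∃ n : ℕ, i < (σ n).head ∧ i < (σ n).text.length) ∧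
      -- the words start where the criterion for a new word says
      (∀ n : ℕ, differences 2 3 (σ n).head =
        Set.Iio ((σ n).text.length - (σ n).head) ∧ (σ n).head < (σ n).text.length) ∧
      (∀ n j : ℕ, j < (ω n).1.length →
        (WordStartsAfter 2 3 ((σ n).head + j) ↔ j = 0 ∧ (ω n).1 ≠ [1])) ∧
      -- each translate records the rows of the upper P-positions in the columns of its word
      (∀ n i : ℕ, i < (ω n).2.length →
        ((ω n).2[i]? = some 1 ↔
          ∃ x : ℕ, (σ n).head < x ∧ x ≤ (σ n).head + (ω n).1.length ∧
            x < (σ n).text.length + i + 1 ∧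
            IsPPosition 2 3 (x, (σ n).text.length + i + 1))) ∧
      -- the word `01000` is always succeeded by the word `1`
      (∀ n : ℕ, (ω n).1 = [0, 1, 0, 0, 0] → (ω (n + 1)).1 = [1]) ∧
      -- the words `0`, `1` are never succeeded by a word that begins with `0`
      (∀ n : ℕ, ¬((ω n).1 = [0] ∧ (ω (n + 1)).1 = [1] ∧ (ω (n + 2)).1.head? = some 0))) ∧
    -- the P-positions lie within bounded distance of the two lines
    (∃ C : ℝ, ∀ x y : ℕ, IsPPosition 2 3 (x, y) →
      (x ≤ y → |(y : ℝ) - Real.goldenRatio * x| ≤ C) ∧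
      (y ≤ x → |(y : ℝ) - x / Real.goldenRatio| ≤ C)) := by
  refine ⟨fun c hc => bitString_eq_one_iff hc, existsUnique_isRun, fun σ ω hrun => ?_, 60,
    fun x y hp => ⟨fun hxy => abs_sub_goldenRatio_mul_le hxy hp, fun hyx => ?_⟩⟩
  · obtain ⟨rfl, rfl⟩ := hrun.eq_process
    dsimp only
    refine ⟨fun n => (correct n).bits, fun i => ⟨i, ?_⟩, fun n => ?_,
      fun n j hj => (correct n).settled.wordStartsAfter_iff (correct n).placed hj,
      fun n i hi => ?_, fun n hn => ?_, fun n => ?_⟩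
    · have := le_process_head i
      have := process_head_add_le i
      omega
    · have := process_head_add_le n
      exact ⟨(correct n).settled.differences_eq, by omega⟩
    · rw [← head_add_gap]
      exact (correct n).placed.translate_eq_one_iff hi
    · rw [letter_after_long]
      · rfl
      · cases h : (process n).letter <;> simp_all [Letter.entry]
    · rintro ⟨h0, h1, h2⟩
      have h := letter_after_zero_one (n := n)
        (by cases h : (process n).letter <;> simp_all [Letter.entry])
        (by cases h : (process (n + 1)).letter <;> simp_all [Letter.entry])
      rw [h] at h2
      exact absurd h2 (by decide)
  · have h := abs_sub_goldenRatio_mul_le hyx hp.symm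
    have hφ := goldenRatio_bounds.1
    have hpos := Real.goldenRatio_pos
    -- The bound for the reflected position is divided by `φ > 1`.
    have heq : (y : ℝ) - x / Real.goldenRatio =
        -((x - Real.goldenRatio * y) / Real.goldenRatio) := by
      field_simp
      ring
    rw [heq, abs_neg, abs_div, abs_of_pos hpos, div_le_iff₀ hpos]
    linarith
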